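/- Let $K$ be a field and let $E=(E^0,E^1,s,r)$ be a finite directed graph (loops and parallel edges allowed). Let $L_K(E)$ be the Leavitt path algebra: the $K$-algebra generated by the $v\in E^0$ and the $e,e^*$, $e\in E^1$, subject to $vu=\delta_{v,u}v$; $s(e)e=er(e)=e$; $r(e)e^*=e^*s(e)=e^*$; $e^*f=\delta_{e,f}r(e)$; and $v=\sum_{s(e)=v}ee^*$ for every $v$ that is not a sink. It is unital, with $1=\sum_{v\in E^0}v$. Let $E^\infty$ be the set of infinite paths $e_1e_2e_3\cdots$ ($r(e_i)=s(e_{i+1})$), where each sink $w$ is also regarded as the infinite path $w=w^\infty=www\cdots$; thus $E^\infty$ also contains $\alpha w^\infty$ for each finite path $\alpha$ ending in a sink $w$. Let $\tau_{>n}(p)$ be $p$ with its first $n$ steps removed. Two elements $p,q\in E^\infty$ are tail-equivalent, $p\sim q$, if $\tau_{>m}(p)=\tau_{>n}(q)$ for some $m,n\geq 0$; $[q]$ is the class of $q$. The Chen simple module $V_{[q]}$ is the $K$-vector space with basis $[q]$ and the left $L_K(E)$-action determined, for $p\in[q]$, by: $v\cdot p=p$ if $v=s(p)$ and $0$ otherwise;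 $e\cdot p=ep$ if $r(e)=s(p)$ and $0$ otherwise; $e^*\cdot p=\tau_{>1}(p)$ if $e$ is the first edge of $p$ and $0$ otherwise. Two such modules are regarded as equal, $V_{[p]}=V_{[q]}$, precisely when $[p]=[q]$. Let $d=e_1\cdots e_n$ ($n\ge 1$) be a closed path, $r(e_n)=s(e_1)$, that is simple, i.e. $d\neq\beta^m$ for every closed path $\beta$ and every $m\geq2$. Put $d^\infty=ddd\cdots\in E^\infty$. For $q\in E^\infty$ put $$L_{(d,q)}=\{p\in E^\infty : p\sim q,\ s(p)=s(d),\ \text{and } p\ne dp' \text{ for all } p'\in E^\infty\}.$$ For an element $m$ of a left $L_K(E)$-module let $\hat\rho_m$ be the homomorphism $a\mapsto am$ from $L_K(E)$ to that module. Then the sequence of left $L_K(E)$-modules $$0\to L_K(E)\xrightarrow{\hat\rho_{d-1}}L_K(E)\xrightarrow{\hat\rho_{d^\infty}}V_{[d^\infty]}\to0$$ is exact. For $q\in E^\infty$ and $T=V_{[q]}$ let $\pi:\operatorname{Hom}_{L_K(E)}(L_K(E),T)\to\operatorname{Ext}^1_{L_K(E)}(V_{[d^\infty]},T)$ be its connecting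 homomorphism. 1. If $T\neq V_{[d^\infty]}$, then $\dim_K\operatorname{Ext}^1_{L_K(E)}(V_{[d^\infty]},T)=|L_{(d,q)}|$, and the family $(\pi(\hat\rho_p))_{p\in L_{(d,q)}}$ is a $K$-basis of $\operatorname{Ext}^1_{L_K(E)}(V_{[d^\infty]},T)$. 2. If $T=V_{[d^\infty]}$, then $\dim_K\operatorname{Ext}^1_{L_K(E)}(V_{[d^\infty]},V_{[d^\infty]})=|L_{(d,d^\infty)}|+1$, where $d^\infty\notin L_{(d,d^\infty)}$, and the family $(\pi(\hat\rho_p))_{p\in L_{(d,d^\infty)}\cup\{d^\infty\}}$ is a $K$-basis of $\operatorname{Ext}^1_{L_K(E)}(V_{[d^\infty]},V_{[d^\infty]})$. Dimensions and cardinalities are cardinal numbers and may be infinite. -/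

import Mathlib

universe u v w

/-- A directed graph `(E⁰, E¹, s, r)` with vertex set `V` and edge set `Edge`; loops and parallel
edges are allowed. -/
structure DirectedGraph (V : Type v) (Edge : Type w) where
  /-- the source of an edge -/
  s : Edge → V
  /-- the range of an edge -/
  r : Edge → V

namespace DirectedGraph

section Graph

variable {V : Type v} {Edge : Type w} (E : DirectedGraph V Edge)

/-- A sink is a vertex that emits no edge. -/
def IsSink (x : V) : Prop := ∀ e : Edge, E.s e ≠ x

/-- A step of an infinite path: either an edge, or, at a sink `w`, the trivial path `w`. -/
abbrev Step : Type (max v w) := Edge ⊕ {x : V // E.IsSink x}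

/-- The source of a step. -/
def stepSource : E.Step → V := Sum.elim E.s Subtype.val

/-- The range of a step. -/
def stepRange : E.Step → V := Sum.elim E.r Subtype.val

/-- The set `E^∞`, with the convention that a sink `w` is identified with `w^∞ = w w w ⋯`.
An element is either an infinite path `e₁ e₂ e₃ ⋯` of edges, or of the form
`e₁ ⋯ eₙ w^∞` for a finite path `e₁ ⋯ eₙ` (with `n ≥ 0`) that ends in a sink `w`
(after a step `w` the only composable step is `w` again, as no edge starts at `w`). -/
@[ext]
structure InfPath where
  /-- the sequence of steps -/
  step : ℕ → E.Step
  /-- consecutive steps are composable -/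
  comp : ∀ n, E.stepRange (step n) = E.stepSource (step (n + 1))

variable {E}

namespace InfPath

/-- The vertex `s(p)`. -/
def source (p : E.InfPath) : V := E.stepSource (p.step 0)

/-- The path `τ_{>n}(p)`. -/
def drop (p : E.InfPath) (n : ℕ) : E.InfPath where
  step i := p.step (n + i)
  comp i := p.comp (n + i)

/-- The path `e p`, defined when `r(e) = s(p)`. -/
def cons (e : Edge) (p : E.InfPath) (h : E.r e = p.source) : E.InfPath where
  step
    | 0 => Sum.inl e
    | n + 1 => p.step n
  comp
    | 0 => h
    | n + 1 => p.comp n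

/-- Tail equivalence: `τ_{>m}(p) = τ_{>n}(q)` for some `m` and `n`. -/
def TailEquiv (p q : E.InfPath) : Prop := ∃ m n : ℕ, p.drop m = q.drop n

theorem drop_drop (p : E.InfPath) (m n : ℕ) : (p.drop m).drop n = p.drop (m + n) := by
  ext i : 2
  exact congrArg p.step (Nat.add_assoc m n i).symm

theorem drop_zero (p : E.InfPath) : p.drop 0 = p := by
  ext i : 2
  exact congrArg p.step (Nat.zero_add i)

theorem drop_one_cons (e : Edge) (p : E.InfPath) (h : E.r e = p.source) :
    (cons e p h).drop 1 = p := by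
  ext i : 2
  change (cons e p h).step (1 + i) = p.step i
  rw [Nat.add_comm]
  rfl

theorem source_drop_one (p : E.InfPath) : (p.drop 1).source = E.stepRange (p.step 0) :=
  (p.comp 0).symm

theorem cons_drop_one (e : Edge) (p : E.InfPath) (h : E.r e = (p.drop 1).source)
    (he : p.step 0 = Sum.inl e) : cons e (p.drop 1) h = p := by
  ext i : 2
  cases i with
  | zero => exact he.symm
  | succ n => exact congrArg p.step (Nat.add_comm 1 n)

theorem tailEquiv_equivalence : Equivalence (TailEquiv (E := E)) where
  refl p := ⟨0, 0, rfl⟩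
  symm := fun ⟨m, n, h⟩ => ⟨n, m, h.symm⟩
  trans := by
    rintro p q t ⟨m, n, h⟩ ⟨k, l, h'⟩
    refine ⟨m + k, l + n, ?_⟩
    rw [← drop_drop, h, drop_drop, Nat.add_comm n k, ← drop_drop, h', drop_drop]

instance setoid : Setoid E.InfPath := ⟨TailEquiv, tailEquiv_equivalence⟩

end InfPath

variable (E) in
/-- The set of tail equivalence classes in `E^∞`. -/
abbrev TailClass : Type (max v w) := Quotient (InfPath.setoid (E := E))

/-- The tail equivalence class `[p]`. -/
def InfPath.tailClass (p : E.InfPath) : E.TailClass := Quotient.mk _ p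

theorem InfPath.tailClass_drop (p : E.InfPath) (n : ℕ) :
    (p.drop n).tailClass = p.tailClass :=
  Quotient.sound ⟨0, n, by rw [drop_zero]⟩

theorem InfPath.tailClass_cons (e : Edge) (p : E.InfPath) (h : E.r e = p.source) :
    (InfPath.cons e p h).tailClass = p.tailClass :=
  Quotient.sound ⟨1, 0, by rw [drop_one_cons, drop_zero]⟩

/-- The elements of `E^∞` that belong to the class `c`. -/
abbrev TailClass.Paths (c : E.TailClass) : Type (max v w) := {p : E.InfPath // p.tailClass = c}

variable (E) in
/-- A closed path: a nonempty sequence `e₁ ⋯ eₙ` of edges with `r(eᵢ) = s(eᵢ₊₁)` for `i < n` and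
`r(eₙ) = s(e₁)`. -/
structure ClosedPath where
  /-- the sequence of edges -/
  edges : List Edge
  /-- the path has positive length -/
  ne_nil : edges ≠ []
  /-- consecutive edges are composable -/
  chain : ∀ (i : ℕ) (h : i + 1 < edges.length), E.r edges[i] = E.s edges[i + 1]
  /-- the path returns to its starting point -/
  closed : E.r (edges.getLast ne_nil) = E.s (edges.head ne_nil)

namespace ClosedPath

/-- The vertex `s(d)`. -/
def source (d : E.ClosedPath) : V := E.s (d.edges.head d.ne_nil)

/-- A closed path is simple if it is not a power `β^m` of a closed path `β` with `m ≥ 2`. -/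
def IsSimple (d : E.ClosedPath) : Prop :=
  ∀ (β : E.ClosedPath) (m : ℕ), 2 ≤ m → d.edges ≠ (List.replicate m β.edges).flatten

theorem length_pos (d : E.ClosedPath) : 0 < d.edges.length :=
  List.length_pos_of_ne_nil d.ne_nil

/-- The infinite path `d^∞ = d d d ⋯`. -/
def infinity (d : E.ClosedPath) : E.InfPath where
  step n := Sum.inl (d.edges[n % d.edges.length]'(Nat.mod_lt n d.length_pos))
  comp n := by
    have hl := d.length_pos
    have hn := Nat.mod_lt n hl
    change E.r (d.edges[n % d.edges.length]'(Nat.mod_lt n hl))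
      = E.s (d.edges[(n + 1) % d.edges.length]'(Nat.mod_lt _ hl))
    by_cases h : n % d.edges.length + 1 < d.edges.length
    · have h2 : (n + 1) % d.edges.length = n % d.edges.length + 1 := by
        rw [Nat.add_mod_eq_ite, if_neg]
        · rw [Nat.mod_eq_of_lt (a := 1) (by omega)]
        · rw [Nat.mod_eq_of_lt (a := 1) (by omega)]; omega
      simp only [h2]
      exact d.chain _ h
    · have h1 : n % d.edges.length = d.edges.length - 1 := by omega
      have h2 : (n + 1) % d.edges.length = 0 := by
        rw [← Nat.mod_add_mod, h1, Nat.sub_add_cancel hl, Nat.mod_self]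
      have h3 := d.closed
      rw [List.getLast_eq_getElem, List.head_eq_getElem] at h3
      simp only [h1, h2]
      exact h3

/-- `p` is divisible by `d` if `p = d p'` for some `p' ∈ E^∞`. -/
def Divides (d : E.ClosedPath) (p : E.InfPath) : Prop :=
  ∃ p' : E.InfPath, (∀ (i : ℕ) (h : i < d.edges.length), p.step i = Sum.inl d.edges[i]) ∧
    ∀ i : ℕ, p.step (d.edges.length + i) = p'.step i

/-- The set `L_{(d,q)}`, for `c = [q]`, of those `p ∈ [q]` that start at `s(d)` and are not
divisible by `d`. -/
def L (d : E.ClosedPath) (c : E.TailClass) : Set c.Paths :=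
  {p | p.1.source = d.source ∧ ¬ d.Divides p.1}

end ClosedPath

end Graph

/-! ### The Leavitt path algebra of a finite graph -/

/-- The generators `v` (`v ∈ E⁰`), `e` and `e*` (`e ∈ E¹`) of the Leavitt path algebra. -/
inductive Generator (V : Type v) (Edge : Type w) : Type (max v w)
  | vertex (x : V)
  | edge (e : Edge)
  | ghost (e : Edge)

section Algebra

variable (K : Type u) [Field K] {V : Type v} {Edge : Type w} [Fintype V] [Fintype Edge]
variable (E : DirectedGraph V Edge)

/-- A generator as an element of the free unital `K`-algebra. -/
abbrev gen (g : Generator V Edge) : FreeAlgebra K (Generator V Edge) := FreeAlgebra.ι K g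

open Classical in
/-- The defining relations (V), (E1), (E2), (CK1), (CK2). As the graph is finite, the algebra that
they define is unital with unit the sum of all vertices; since the free algebra we start from is
unital, this identification of the unit is added to the relations. -/
inductive LeavittRel : FreeAlgebra K (Generator V Edge) → FreeAlgebra K (Generator V Edge) → Prop
  | vertex_mul_vertex (x y : V) :
      LeavittRel (gen K (.vertex x) * gen K (.vertex y)) (if x = y then gen K (.vertex x) else 0)
  | source_mul_edge (e : Edge) :
      LeavittRel (gen K (.vertex (E.s e)) * gen K (.edge e)) (gen K (.edge e))
  | edge_mul_range (e : Edge) :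
      LeavittRel (gen K (.edge e) * gen K (.vertex (E.r e))) (gen K (.edge e))
  | range_mul_ghost (e : Edge) :
      LeavittRel (gen K (.vertex (E.r e)) * gen K (.ghost e)) (gen K (.ghost e))
  | ghost_mul_source (e : Edge) :
      LeavittRel (gen K (.ghost e) * gen K (.vertex (E.s e))) (gen K (.ghost e))
  | ck1 (e f : Edge) :
      LeavittRel (gen K (.ghost e) * gen K (.edge f)) (if e = f then gen K (.vertex (E.r e)) else 0)
  | ck2 (x : V) (hx : ¬ E.IsSink x) :
      LeavittRel (gen K (.vertex x))
        (∑ e : Edge with E.s e = x, gen K (.edge e) * gen K (.ghost e))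
  | one : LeavittRel (∑ x : V, gen K (.vertex x)) 1

/-- The Leavitt path algebra `L_K(E)` of a finite graph `E`. -/
def LeavittPathAlgebra : Type (max u v w) := RingQuot (LeavittRel K E)

noncomputable instance : Ring (LeavittPathAlgebra K E) :=
  inferInstanceAs (Ring (RingQuot (LeavittRel K E)))

noncomputable instance : Algebra K (LeavittPathAlgebra K E) :=
  inferInstanceAs (Algebra K (RingQuot (LeavittRel K E)))

/-- The image of a generator in `L_K(E)`. -/
noncomputable def LeavittPathAlgebra.of (g : Generator V Edge) : LeavittPathAlgebra K E :=
  RingQuot.mkAlgHom K (LeavittRel K E) (FreeAlgebra.ι K g)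

variable {E} in
/-- The closed path `d = e₁ ⋯ eₙ` as an element of `L_K(E)`. -/
noncomputable def ClosedPath.toAlgebra (d : E.ClosedPath) : LeavittPathAlgebra K E :=
  (d.edges.map fun e => LeavittPathAlgebra.of K E (.edge e)).prod

end Algebra

/-! ### Chen simple modules -/

section Chen

variable (K : Type u) [Field K] {V : Type v} {Edge : Type w}
variable {E : DirectedGraph V Edge}

/-- The `K`-vector space `V_{[q]}` with basis the tail equivalence class `c = [q]`. For a class of
a sink `w` its basis is in bijection with the finite paths that end in `w`. -/
def ChenModule (c : E.TailClass) : Type (max u v w) := c.Paths →₀ K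

namespace ChenModule

variable (c : E.TailClass)

noncomputable instance : AddCommGroup (ChenModule K c) :=
  inferInstanceAs (AddCommGroup (c.Paths →₀ K))

noncomputable instance : Module K (ChenModule K c) :=
  inferInstanceAs (Module K (c.Paths →₀ K))

variable {c} in
/-- A path `p ∈ [q]` as a basis vector of `V_{[q]}`. -/
noncomputable def ofPath (p : c.Paths) : ChenModule K c := Finsupp.single p (1 : K)

/-- The `K`-linear extension of a map given on the basis of paths. -/
noncomputable def extend (f : c.Paths → ChenModule K c) : Module.End K (ChenModule K c) :=
  Finsupp.linearCombination K f

theorem extend_ofPath (f : c.Paths → ChenModule K c) (p : c.Paths) :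
    extend K c f (ofPath K p) = f p := by
  change Finsupp.linearCombination K f (Finsupp.single p 1) = f p
  rw [Finsupp.linearCombination_single, one_smul]

theorem end_ext {f g : Module.End K (ChenModule K c)}
    (h : ∀ p : c.Paths, f (ofPath K p) = g (ofPath K p)) : f = g :=
  Finsupp.lhom_ext' fun p => LinearMap.ext_ring (h p)

open Classical in
/-- The action of the generators on the basis: `v · p = p` if `v = s(p)` and `0` otherwise;
`e · p = e p` if `r(e) = s(p)` and `0` otherwise; `e* · p = τ_{>1}(p)` if `e` is the first edge of
`p` and `0` otherwise. -/
noncomputable def basisAct : Generator V Edge → c.Paths → ChenModule K c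
  | .vertex x, p => if x = p.1.source then ofPath K p else 0
  | .edge e, p =>
      if h : E.r e = p.1.source then
        ofPath K ⟨p.1.cons e h, (InfPath.tailClass_cons e p.1 h).trans p.2⟩
      else 0
  | .ghost e, p =>
      if p.1.step 0 = Sum.inl e then
        ofPath K ⟨p.1.drop 1, (InfPath.tailClass_drop p.1 1).trans p.2⟩
      else 0

/-- The action of the free algebra on `V_{[q]}`. -/
noncomputable def freeAct :
    FreeAlgebra K (Generator V Edge) →ₐ[K] Module.End K (ChenModule K c) :=
  FreeAlgebra.lift K fun g => extend K c (basisAct K c g)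

theorem freeAct_gen (g : Generator V Edge) (p : c.Paths) :
    freeAct K c (gen K g) (ofPath K p) = basisAct K c g p := by
  simp only [freeAct, gen, FreeAlgebra.lift_ι_apply, extend_ofPath]

variable [Fintype V] [Fintype Edge]

theorem freeAct_rel {a b : FreeAlgebra K (Generator V Edge)} (h : LeavittRel K E a b) :
    freeAct K c a = freeAct K c b := by
  classical
  refine end_ext K c fun p => ?_
  cases h with
  | vertex_mul_vertex x y =>
    rw [map_mul, Module.End.mul_apply, freeAct_gen]
    by_cases hxy : x = y
    · subst hxy
      rw [if_pos rfl, freeAct_gen]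
      by_cases hx : x = p.1.source
      · simp only [basisAct, if_pos hx, freeAct_gen]
      · simp only [basisAct, if_neg hx, map_zero]
    · rw [if_neg hxy, map_zero, LinearMap.zero_apply]
      by_cases hy : y = p.1.source
      · have hx : ¬ x = p.1.source := fun hx => hxy (hx.trans hy.symm)
        simp only [basisAct, if_pos hy, freeAct_gen, if_neg hx]
      · simp only [basisAct, if_neg hy, map_zero]
  | source_mul_edge e =>
    rw [map_mul, Module.End.mul_apply, freeAct_gen]
    by_cases he : E.r e = p.1.source
    · simp only [basisAct, dif_pos he, freeAct_gen]
      exact if_pos rfl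
    · simp only [basisAct, dif_neg he, map_zero]
  | edge_mul_range e =>
    rw [map_mul, Module.End.mul_apply, freeAct_gen, freeAct_gen]
    by_cases he : E.r e = p.1.source
    · simp only [basisAct, if_pos he, freeAct_gen]
    · simp only [basisAct, if_neg he, dif_neg he, map_zero]
  | range_mul_ghost e =>
    rw [map_mul, Module.End.mul_apply, freeAct_gen]
    by_cases he : p.1.step 0 = Sum.inl e
    · simp only [basisAct, if_pos he, freeAct_gen]
      refine if_pos ?_
      rw [InfPath.source_drop_one, he]
      rfl
    · simp only [basisAct, if_neg he, map_zero]
  | ghost_mul_source e =>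
    rw [map_mul, Module.End.mul_apply, freeAct_gen, freeAct_gen]
    by_cases he : E.s e = p.1.source
    · simp only [basisAct, if_pos he, freeAct_gen]
    · have h' : ¬ p.1.step 0 = Sum.inl e := fun h => he (by rw [InfPath.source, h]; rfl)
      simp only [basisAct, if_neg he, if_neg h', map_zero]
  | ck1 e f =>
    rw [map_mul, Module.End.mul_apply, freeAct_gen]
    by_cases hf : E.r f = p.1.source
    · simp only [basisAct, dif_pos hf, freeAct_gen]
      by_cases hef : e = f
      · subst hef
        rw [if_pos rfl, freeAct_gen]
        simp only [basisAct, if_pos hf]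
        refine (if_pos rfl).trans (congrArg _ (Subtype.ext ?_))
        exact InfPath.drop_one_cons _ _ hf
      · rw [if_neg hef, map_zero, LinearMap.zero_apply]
        exact if_neg fun h => hef (Sum.inl.inj h).symm
    · by_cases hef : e = f
      · subst hef
        rw [if_pos rfl, freeAct_gen]
        simp only [basisAct, dif_neg hf, if_neg hf, map_zero]
      · simp only [basisAct, dif_neg hf, if_neg hef, map_zero, LinearMap.zero_apply]
  | ck2 x hx =>
    have key : ∀ e : Edge, freeAct K c (gen K (.edge e) * gen K (.ghost e)) (ofPath K p)
        = if p.1.step 0 = Sum.inl e then ofPath K p else 0 := by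
      intro e
      rw [map_mul, Module.End.mul_apply, freeAct_gen]
      by_cases he : p.1.step 0 = Sum.inl e
      · have h' : E.r e = (p.1.drop 1).source := by
          rw [InfPath.source_drop_one, he]
          rfl
        simp only [basisAct, if_pos he, freeAct_gen, dif_pos h']
        exact congrArg _ (Subtype.ext (InfPath.cons_drop_one e p.1 h' he))
      · simp only [basisAct, if_neg he, map_zero]
    rw [map_sum, LinearMap.sum_apply, freeAct_gen]
    simp only [key, basisAct]
    rcases h0 : p.1.step 0 with f | w
    · have hs : p.1.source = E.s f := by rw [InfPath.source, h0]; rfl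
      rw [hs]
      simp only [Sum.inl.injEq, Finset.sum_ite_eq, Finset.mem_filter, Finset.mem_univ, true_and]
      simp only [eq_comm]
    · have hs : p.1.source = w.1 := by rw [InfPath.source, h0]; rfl
      have hw : ¬ x = p.1.source := fun h => hx (by rw [h, hs]; exact w.2)
      simp [if_neg hw]
  | one =>
    rw [map_sum, LinearMap.sum_apply, map_one, Module.End.one_apply]
    simp only [freeAct_gen, basisAct, Finset.sum_ite_eq', Finset.mem_univ,
      if_true]

variable (E) in
/-- The algebra homomorphism `L_K(E) → End_K(V_{[q]})` that gives the module structure. -/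
noncomputable def act : LeavittPathAlgebra K E →ₐ[K] Module.End K (ChenModule K c) :=
  RingQuot.liftAlgHom K ⟨freeAct K c, fun _ _ h => freeAct_rel K c h⟩

noncomputable instance : Module (LeavittPathAlgebra K E) (ChenModule K c) :=
  Module.compHom (ChenModule K c) (act K E c).toRingHom

end ChenModule

end Chen

/-! ### Right multiplications and the connecting homomorphism -/

section Resolution

open CategoryTheory

variable (K : Type u) [Field K] {V : Type v} {Edge : Type w} [Fintype V] [Fintype Edge]
variable {E : DirectedGraph V Edge}

variable (E) in
/-- The left regular module `L_K(E)`. -/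
noncomputable abbrev regularModule : ModuleCat.{max u v w} (LeavittPathAlgebra K E) :=
  ModuleCat.of (LeavittPathAlgebra K E) (LeavittPathAlgebra K E)

/-- The left `L_K(E)`-module `V_{[q]}`, for `c = [q]`. -/
noncomputable abbrev chenModule (c : E.TailClass) :
    ModuleCat.{max u v w} (LeavittPathAlgebra K E) :=
  ModuleCat.of (LeavittPathAlgebra K E) (ChenModule K c)

variable {K} in
/-- For `m` in a left `L_K(E)`-module `M`, the homomorphism `ρ̂_m : L_K(E) → M`, `a ↦ a m`. -/
noncomputable def rho {M : ModuleCat.{max u v w} (LeavittPathAlgebra K E)} (m : M) :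
    regularModule K E ⟶ M :=
  ModuleCat.ofHom (LinearMap.toSpanSingleton (LeavittPathAlgebra K E) M m)

/-- `ρ̂_{d-1} : L_K(E) → L_K(E)`, right multiplication by `d - 1`. -/
noncomputable def rhoSubOne (d : E.ClosedPath) : regularModule K E ⟶ regularModule K E :=
  rho (M := regularModule K E) (d.toAlgebra K - 1)

/-- `ρ̂_p : L_K(E) → V_{[q]}` for a path `p ∈ [q]`. -/
noncomputable def rhoPath {c : E.TailClass} (p : c.Paths) : regularModule K E ⟶ chenModule K c :=
  rho (M := chenModule K c) (ChenModule.ofPath K p)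

/-- `d^∞` as an element of its own tail equivalence class. -/
def ClosedPath.infinityMem (d : E.ClosedPath) : d.infinity.tailClass.Paths := ⟨d.infinity, rfl⟩

variable {K} in
/-- The connecting homomorphism `Hom(X₁, T) → Ext¹(X₃, T)` of a short exact sequence
`0 → X₁ → X₂ → X₃ → 0`, i.e. the Yoneda product with the class of the sequence. -/
noncomputable def connecting {S : ShortComplex (ModuleCat.{max u v w} (LeavittPathAlgebra K E))}
    (hS : S.ShortExact) {T : ModuleCat.{max u v w} (LeavittPathAlgebra K E)} (φ : S.X₁ ⟶ T) :
    Abelian.Ext.{max u v w} S.X₃ T 1 :=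
  hS.extClass.comp (Abelian.Ext.mk₀ φ) (add_zero 1)

end Resolution

end DirectedGraph

/-! Write `N` for the length of `d` and `T` for `V_{[q]}`. The regular module is projective and each
homomorphism from it to `T` is some `ρ̂_m`, so the long exact sequence of `Hom(-, T)` identifies
`Ext¹(V_{[d^∞]}, T)` with `T / (d - 1) T` through `m ↦ π(ρ̂_m)` (`connectingRho_surjective`,
`connectingRho_eq_zero_iff`).

This needs the exact sequence. Right multiplication by `d - 1` is injective because `L_K(E)` is
graded by length: if `a d = a`, then `a` has no component of lowest degree. In the middle, `L_K(E) /
L_K(E)(d - 1)` is spanned by the classes of finite paths `α` for which `α d^∞` is defined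
(`span_segments`). Such a class depends only on the infinite path `α d^∞`, because every period of
`d^∞` is a multiple of `N` when `d` is simple. Hence `a ↦ a d^∞` is injective on the quotient.

The cokernel of `d - 1` on `T` is read off from the basis of paths. A path that does not start at
`s(d)` is killed by `d` and so lies in `(d - 1) T`; for the others `d p ≡ p`. Cancelling `d` from
the front ends at a unique path that is not divisible by `d`, unless the path is `d^∞`. The paths
where this ends form `terminal`, which is `L_{(d,q)}` with `d^∞` added when `d^∞ ∈ [q]`;
`retraction` shows that they stay independent modulo `(d - 1) T`. -/

namespace DirectedGraph

/-! ### Infinite paths, divisibility by `d` and the periods of `d^∞`. -/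

section Paths

variable {V : Type v} {Edge : Type w} {E : DirectedGraph V Edge}

namespace InfPath

theorem source_drop_succ (p : E.InfPath) (n : ℕ) :
    (p.drop (n + 1)).source = E.stepRange (p.step n) :=
  (p.comp n).symm

/-- No edge leaves a sink. It follows that everything in front of a tail `d^∞` consists of edges. -/
theorem exists_step_eq_inl_of_succ (p : E.InfPath) {n : ℕ}
    (h : ∃ e, p.step (n + 1) = Sum.inl e) : ∃ e, p.step n = Sum.inl e := by
  obtain ⟨e, he⟩ := h
  rcases hw : p.step n with f | x
  · exact ⟨f, rfl⟩
  · have hc := p.comp n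
    rw [he, hw] at hc
    exact (x.2 e hc.symm).elim

theorem exists_step_eq_inl_of_le (p : E.InfPath) {m n : ℕ} (hmn : m ≤ n)
    (h : ∃ e, p.step n = Sum.inl e) : ∃ e, p.step m = Sum.inl e := by
  induction n, hmn using Nat.le_induction with
  | base => exact h
  | succ n _ ih => exact ih (p.exists_step_eq_inl_of_succ h)

theorem cons_drop_succ (e : Edge) (p : E.InfPath) (h : E.r e = p.source) (n : ℕ) :
    (cons e p h).drop (n + 1) = p.drop n := by
  rw [Nat.add_comm, ← drop_drop, drop_one_cons]

end InfPath

namespace ClosedPath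

variable (d : E.ClosedPath)

theorem infinity_step_of_lt {i : ℕ} (h : i < d.edges.length) :
    d.infinity.step i = Sum.inl d.edges[i] := by
  simp [infinity, Nat.mod_eq_of_lt h]

theorem infinity_step_add_length (i : ℕ) :
    d.infinity.step (d.edges.length + i) = d.infinity.step i := by
  simp [infinity]

theorem infinity_drop_length : d.infinity.drop d.edges.length = d.infinity := by
  ext i : 2
  exact d.infinity_step_add_length i

theorem infinity_drop_mul_length (k : ℕ) :
    d.infinity.drop (k * d.edges.length) = d.infinity := by
  induction k with
  | zero => rw [Nat.zero_mul, InfPath.drop_zero]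
  | succ k ih => rw [Nat.succ_mul, ← InfPath.drop_drop, ih, infinity_drop_length]

theorem exists_infinity_step_eq_inl (n : ℕ) : ∃ e, d.infinity.step n = Sum.inl e := ⟨_, rfl⟩

theorem source_infinity : d.infinity.source = d.source := by
  rw [InfPath.source, d.infinity_step_of_lt d.length_pos, source, List.head_eq_getElem]
  rfl

theorem divides_iff (p : E.InfPath) :
    d.Divides p ↔ ∀ i < d.edges.length, p.step i = d.infinity.step i := by
  constructor
  · rintro ⟨_, h, _⟩ i hi
    rw [h i hi, d.infinity_step_of_lt hi]
  · intro h
    exact ⟨p.drop d.edges.length, fun i hi => by rw [h i hi, d.infinity_step_of_lt hi],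
      fun _ => rfl⟩

theorem divides_infinity : d.Divides d.infinity := (d.divides_iff _).mpr fun _ _ => rfl

/-- The path `d p`, defined when `s(p) = s(d)`. -/
def append (p : E.InfPath) (h : p.source = d.source) : E.InfPath where
  step i := if i < d.edges.length then d.infinity.step i else p.step (i - d.edges.length)
  comp i := by
    by_cases h1 : i + 1 < d.edges.length
    · rw [if_pos h1, if_pos (by omega)]
      exact d.infinity.comp i
    · by_cases h2 : i < d.edges.length
      · rw [if_pos h2, if_neg h1, d.infinity.comp i]
        have h3 : i + 1 = d.edges.length := by omega
        have h4 := d.infinity_step_add_length 0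
        rw [h3, Nat.sub_self]
        rw [Nat.add_zero] at h4
        rw [h4]
        exact d.source_infinity.trans h.symm
      · rw [if_neg h2, if_neg h1, Nat.sub_add_comm (not_lt.mp h2)]
        exact p.comp _

theorem append_drop_length (p : E.InfPath) (h : p.source = d.source) :
    (d.append p h).drop d.edges.length = p := by
  ext i : 2
  simp [InfPath.drop, append]

theorem divides_append (p : E.InfPath) (h : p.source = d.source) : d.Divides (d.append p h) :=
  (d.divides_iff _).mpr fun _ hi => if_pos hi

theorem source_of_divides {p : E.InfPath} (h : d.Divides p) : p.source = d.source := by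
  rw [← source_infinity, InfPath.source, InfPath.source, (d.divides_iff p).mp h 0 d.length_pos]

theorem source_drop_of_divides {p : E.InfPath} (h : d.Divides p) :
    (p.drop d.edges.length).source = d.source := by
  rw [← source_infinity]
  obtain ⟨n, hn⟩ : ∃ n, d.edges.length = n + 1 := ⟨_, (Nat.succ_pred d.length_pos.ne').symm⟩
  conv_rhs => rw [← infinity_drop_length]
  rw [hn, InfPath.source_drop_succ, InfPath.source_drop_succ,
    (d.divides_iff p).mp h n (by omega)]

theorem tailClass_append (p : E.InfPath) (h : p.source = d.source) :
    (d.append p h).tailClass = p.tailClass := by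
  rw [← InfPath.tailClass_drop _ d.edges.length, append_drop_length]

theorem exists_drop_eq_infinity (p : d.infinity.tailClass.Paths) :
    ∃ m, p.1.drop m = d.infinity := by
  obtain ⟨m, n, h⟩ : InfPath.TailEquiv p.1 d.infinity := Quotient.exact p.2
  -- Tail equivalence may cut `d^∞` in the middle of a turn; `k` further steps lead to a multiple of
  -- `N`, where `d^∞` starts afresh.
  obtain ⟨k, hk⟩ : ∃ k, n + k = n * d.edges.length :=
    ⟨n * d.edges.length - n, Nat.add_sub_cancel' (Nat.le_mul_of_pos_right n d.length_pos)⟩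
  refine ⟨m + k, ?_⟩
  rw [← InfPath.drop_drop, h, InfPath.drop_drop, hk, infinity_drop_mul_length]

/-- A path that agrees with `d^∞` up to every multiple of the length of `d` equals `d^∞`. -/
theorem eq_infinity_of_forall_divides {p : E.InfPath}
    (h : ∀ k, d.Divides (p.drop (k * d.edges.length))) : p = d.infinity := by
  ext i : 2
  have h1 := (d.divides_iff _).mp (h (i / d.edges.length)) (i % d.edges.length)
    (Nat.mod_lt _ d.length_pos)
  have h2 := congrArg (fun t => t.step (i % d.edges.length))
    (d.infinity_drop_mul_length (i / d.edges.length))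
  simp only [InfPath.drop, Nat.div_add_mod'] at h1 h2
  rw [h1, ← h2]

/-- If `d` is simple then every period of `d^∞` is a multiple of the length of `d`. -/
theorem IsSimple.length_dvd_of_drop_eq {d : E.ClosedPath} (hd : d.IsSimple) {j : ℕ}
    (hj : d.infinity.drop j = d.infinity) : d.edges.length ∣ j := by
  set N := d.edges.length with hN
  have hNpos : 0 < N := d.length_pos
  have per (u : ℕ) : d.infinity.drop (u * j) = d.infinity := by
    induction u with
    | zero => rw [Nat.zero_mul, InfPath.drop_zero]
    | succ k ih => rw [Nat.succ_mul, ← InfPath.drop_drop, ih, hj]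
  -- By Bézout `g` is congruent to a multiple of `j` modulo `N`, so it is again a period of `d^∞`.
  -- The first `g` edges of `d` then form a closed path `β` with `d = β^(N/g)`, and simplicity
  -- leaves only `g = N`.
  set g := Nat.gcd j N with hg
  have hgpos : 0 < g := Nat.gcd_pos_of_pos_right _ hNpos
  obtain ⟨m, hm⟩ : g ∣ N := Nat.gcd_dvd_right _ _
  have hgper : d.infinity.drop g = d.infinity := by
    by_cases hgN : g = N
    · rw [hgN, infinity_drop_length]
    · have hlt : g < N := lt_of_le_of_ne (Nat.le_of_dvd hNpos (Nat.gcd_dvd_right _ _)) hgN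
      obtain ⟨u, _, hu⟩ := Nat.exists_mul_mod_eq_gcd (k := N) (n := j) hlt
      have h1 := per u
      rw [Nat.mul_comm, ← Nat.div_add_mod' (j * u) N, hu, ← InfPath.drop_drop,
        infinity_drop_mul_length] at h1
      exact h1
  have hgmul (k : ℕ) : d.infinity.drop (k * g) = d.infinity := by
    induction k with
    | zero => rw [Nat.zero_mul, InfPath.drop_zero]
    | succ k ih => rw [Nat.succ_mul, ← InfPath.drop_drop, ih, hgper]
  by_cases hm1 : m = 1
  · rw [hm, hm1, Nat.mul_one]
    exact Nat.gcd_dvd_left _ _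
  exfalso
  have hm2 : 2 ≤ m := by
    rcases m with _ | _ | m
    · simp only [Nat.mul_zero] at hm; omega
    · exact (hm1 rfl).elim
    · omega
  have hgle : g ≤ N := Nat.le_of_dvd hNpos (Nat.gcd_dvd_right _ _)
  have hlen : (d.edges.take g).length = g := by simp [← hN, hgle]
  have hne : d.edges.take g ≠ [] := List.ne_nil_of_length_pos (by omega)
  let β : E.ClosedPath :=
    { edges := d.edges.take g
      ne_nil := hne
      chain := fun i h => by
        simp only [List.getElem_take]
        exact d.chain i (by omega)
      closed := by
        -- `β` closes up because the edge of `d^∞` at position `g` is the one at position `0`.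
        have hc := d.infinity.comp (g - 1)
        have h0 := congrArg (fun t => t.step 0) hgper
        simp only [InfPath.drop, Nat.add_zero] at h0
        rw [Nat.sub_add_cancel hgpos, h0, d.infinity_step_of_lt (by omega),
          d.infinity_step_of_lt d.length_pos] at hc
        rw [List.getLast_eq_getElem, List.head_eq_getElem]
        simp only [List.getElem_take, hlen]
        exact hc }
  refine hd β m hm2 ?_
  have hblock (k : ℕ) (hk : k ≤ m) :
      (List.replicate k β.edges).flatten = d.edges.take (k * g) := by
    induction k with
    | zero => simp
    | succ k ih =>
      rw [List.replicate_succ', List.flatten_append, ih (by omega), List.flatten_singleton,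
        Nat.succ_mul, List.take_add]
      congr 1
      have hkg : k * g + g ≤ N := by
        rw [hm, ← Nat.succ_mul, Nat.mul_comm]
        exact Nat.mul_le_mul_left _ hk
      refine List.ext_getElem (by simp [β]; omega) fun i h1 h2 => ?_
      simp only [β, List.getElem_take, List.getElem_drop]
      have hig : i < g := hlen ▸ h1
      have h3 := congrArg (fun t => t.step i) (hgmul k)
      simp only [InfPath.drop] at h3
      rw [d.infinity_step_of_lt (by omega), d.infinity_step_of_lt (by omega)] at h3
      exact (Sum.inl.inj h3).symm
  rw [hblock m le_rfl, Nat.mul_comm, ← hm, hN, List.take_length]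

end ClosedPath

end Paths

end DirectedGraph
namespace DirectedGraph

/-! ### Relations and grading of `L_K(E)`; injectivity of right multiplication by `d - 1`. -/

section LeavittAlgebra

variable (K : Type u) [Field K] {V : Type v} {Edge : Type w} [Fintype V] [Fintype Edge]
variable (E : DirectedGraph V Edge)

namespace LeavittPathAlgebra

/-- The quotient map from the free algebra to `L_K(E)`. -/
noncomputable def mk : FreeAlgebra K (Generator V Edge) →ₐ[K] LeavittPathAlgebra K E :=
  RingQuot.mkAlgHom K (LeavittRel K E)

theorem mk_gen (g : Generator V Edge) : mk K E (gen K g) = of K E g := rfl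

theorem mk_surjective : Function.Surjective (mk K E) :=
  RingQuot.mkAlgHom_surjective K (LeavittRel K E)

theorem mk_eq_of_rel {a b : FreeAlgebra K (Generator V Edge)} (h : LeavittRel K E a b) :
    mk K E a = mk K E b :=
  RingQuot.mkAlgHom_rel K h

theorem vertex_mul_edge_source (e : Edge) :
    of K E (.vertex (E.s e)) * of K E (.edge e) = of K E (.edge e) := by
  have h := mk_eq_of_rel K E (LeavittRel.source_mul_edge e)
  rwa [map_mul] at h

theorem edge_mul_vertex_range (e : Edge) :
    of K E (.edge e) * of K E (.vertex (E.r e)) = of K E (.edge e) := by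
  have h := mk_eq_of_rel K E (LeavittRel.edge_mul_range e)
  rwa [map_mul] at h

theorem vertex_mul_vertex_of_ne {x y : V} (hxy : x ≠ y) :
    of K E (.vertex x) * of K E (.vertex y) = 0 := by
  have h := mk_eq_of_rel K E (LeavittRel.vertex_mul_vertex x y)
  rwa [map_mul, if_neg hxy, map_zero] at h

theorem ghost_mul_edge_self (e : Edge) :
    of K E (.ghost e) * of K E (.edge e) = of K E (.vertex (E.r e)) := by
  have h := mk_eq_of_rel K E (LeavittRel.ck1 e e)
  rwa [map_mul, if_pos rfl] at h

theorem ghost_mul_edge_of_ne {e f : Edge} (hef : e ≠ f) :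
    of K E (.ghost e) * of K E (.edge f) = 0 := by
  have h := mk_eq_of_rel K E (LeavittRel.ck1 e f)
  rwa [map_mul, if_neg hef, map_zero] at h

theorem vertex_mul_edge_of_ne {x : V} {e : Edge} (h : x ≠ E.s e) :
    of K E (.vertex x) * of K E (.edge e) = 0 := by
  rw [← vertex_mul_edge_source, ← mul_assoc, vertex_mul_vertex_of_ne K E h, zero_mul]

theorem edge_mul_edge_of_ne {e f : Edge} (h : E.r e ≠ E.s f) :
    of K E (.edge e) * of K E (.edge f) = 0 := by
  rw [← edge_mul_vertex_range, mul_assoc, vertex_mul_edge_of_ne K E h, mul_zero]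

theorem adjoin_range_of : Algebra.adjoin K (Set.range (of K E)) = ⊤ := by
  have h := congrArg (Subalgebra.map (mk K E)) (FreeAlgebra.adjoin_range_ι K (Generator V Edge))
  rw [AlgHom.map_adjoin, ← Set.range_comp, Algebra.map_top,
    (AlgHom.range_eq_top (mk K E)).mpr (mk_surjective K E)] at h
  exact h

/-- Two algebra homomorphisms from `L_K(E)` that agree on the generators are equal. -/
theorem hom_ext {A : Type*} [Ring A] [Algebra K A] {f g : LeavittPathAlgebra K E →ₐ[K] A}
    (h : ∀ x, f (of K E x) = g (of K E x)) : f = g := by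
  refine AlgHom.ext_of_adjoin_eq_top (adjoin_range_of K E) ?_
  rintro _ ⟨x, rfl⟩
  exact h x

/-! ### The grading of the Leavitt path algebra -/

/-- The degree of a generator. -/
def degree : Generator V Edge → ℤ
  | .vertex _ => 0
  | .edge _ => 1
  | .ghost _ => -1

/-- The algebra homomorphism from the free algebra that underlies the grading. -/
noncomputable def freeGrading :
    FreeAlgebra K (Generator V Edge) →ₐ[K] AddMonoidAlgebra (LeavittPathAlgebra K E) ℤ :=
  FreeAlgebra.lift K fun g => AddMonoidAlgebra.single (degree g) (of K E g)

theorem freeGrading_gen (g : Generator V Edge) :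
    freeGrading K E (gen K g) = AddMonoidAlgebra.single (degree g) (of K E g) :=
  FreeAlgebra.lift_ι_apply _ _

/-- Each defining relation is homogeneous, so it becomes the same relation in `L_K(E)` placed in a
single degree. -/
theorem freeGrading_rel {a b : FreeAlgebra K (Generator V Edge)} (h : LeavittRel K E a b) :
    freeGrading K E a = freeGrading K E b := by
  classical
  have hrel := mk_eq_of_rel K E h
  cases h with
  | vertex_mul_vertex x y =>
    split_ifs at hrel ⊢ <;>
    simp only [map_mul, map_zero, mk_gen, freeGrading_gen, AddMonoidAlgebra.single_mul_single, degree,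
      add_zero] at hrel ⊢
    · exact congrArg _ hrel
    · exact (congrArg _ hrel).trans (AddMonoidAlgebra.single_zero _)
  | source_mul_edge e =>
    simp only [map_mul, mk_gen, freeGrading_gen, AddMonoidAlgebra.single_mul_single, degree,
      zero_add] at hrel ⊢
    exact congrArg _ hrel
  | edge_mul_range e =>
    simp only [map_mul, mk_gen, freeGrading_gen, AddMonoidAlgebra.single_mul_single, degree,
      add_zero] at hrel ⊢
    exact congrArg _ hrel
  | range_mul_ghost e =>
    simp only [map_mul, mk_gen, freeGrading_gen, AddMonoidAlgebra.single_mul_single, degree,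
      zero_add] at hrel ⊢
    exact congrArg _ hrel
  | ghost_mul_source e =>
    simp only [map_mul, mk_gen, freeGrading_gen, AddMonoidAlgebra.single_mul_single, degree,
      add_zero] at hrel ⊢
    exact congrArg _ hrel
  | ck1 e f =>
    split_ifs at hrel ⊢ <;>
    simp only [map_mul, map_zero, mk_gen, freeGrading_gen, AddMonoidAlgebra.single_mul_single, degree,
      neg_add_cancel] at hrel ⊢
    · exact congrArg _ hrel
    · exact (congrArg _ hrel).trans (AddMonoidAlgebra.single_zero _)
  | ck2 x hx =>
    simp only [map_mul, map_sum, mk_gen, freeGrading_gen, AddMonoidAlgebra.single_mul_single, degree,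
      add_neg_cancel] at hrel ⊢
    refine (congrArg (AddMonoidAlgebra.singleAddHom (0 : ℤ)) hrel).trans ?_
    rw [map_sum]
    rfl
  | one =>
    simp only [map_sum, map_one, mk_gen, freeGrading_gen, degree] at hrel ⊢
    rw [AddMonoidAlgebra.one_def, ← hrel]
    exact (map_sum (AddMonoidAlgebra.singleAddHom (0 : ℤ)) _ _).symm

/-- The grading of `L_K(E)` by length, as an algebra homomorphism to the Laurent polynomials. -/
noncomputable def grading :
    LeavittPathAlgebra K E →ₐ[K] AddMonoidAlgebra (LeavittPathAlgebra K E) ℤ :=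
  RingQuot.liftAlgHom K ⟨freeGrading K E, fun _ _ h => freeGrading_rel K E h⟩

theorem grading_of (g : Generator V Edge) :
    grading K E (of K E g) = AddMonoidAlgebra.single (degree g) (of K E g) := by
  exact (RingQuot.liftAlgHom_mkAlgHom_apply K _ (fun _ _ h => freeGrading_rel K E h) _).trans
    (freeGrading_gen K E g)

theorem grading_injective : Function.Injective (grading K E) := by
  -- Setting the Laurent variable to `1` forgets the degrees and is a left inverse.
  let ev : AddMonoidAlgebra (LeavittPathAlgebra K E) ℤ →ₐ[K] LeavittPathAlgebra K E :=
    AddMonoidAlgebra.liftNCAlgHom (AlgHom.id K _) 1 fun _ _ => Commute.one_right _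
  have h : ev.comp (grading K E) = AlgHom.id K _ := by
    refine hom_ext K E fun g => ?_
    rw [AlgHom.comp_apply, grading_of]
    simp only [ev, AddMonoidAlgebra.coe_liftNCAlgHom]
    exact (AddMonoidAlgebra.liftNC_single _ _ _ _).trans (mul_one _)
  exact Function.LeftInverse.injective (g := ev) fun a => DFunLike.congr_fun h a

end LeavittPathAlgebra

/-- An element of positive degree does not have the eigenvalue `1` on Laurent polynomials. -/
theorem _root_.AddMonoidAlgebra.eq_zero_of_mul_single_eq_self {R : Type*} [Ring R]
    {x : AddMonoidAlgebra R ℤ} {n : ℤ} (hn : 0 < n) {r : R}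
    (h : x * AddMonoidAlgebra.single n r = x) : x = 0 := by
  by_contra hx
  have hne : x.coeff.support.Nonempty := by
    rw [Finsupp.support_nonempty_iff]
    intro h0
    exact hx (AddMonoidAlgebra.coeff_injective h0)
  set j := x.coeff.support.min' hne with hj
  have hjm : j ∈ x.coeff.support := Finset.min'_mem _ _
  -- The coefficient of the product in the lowest degree `j` can only come from degree `j - n < j`.
  have h1 : x.coeff (j + -n) = 0 := by
    by_contra h2
    have := Finset.min'_le _ _ (Finsupp.mem_support_iff.mpr h2)
    omega
  have h2 : (x * AddMonoidAlgebra.single n r).coeff j = x.coeff j := by rw [h]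
  rw [AddMonoidAlgebra.coeff_mul_single_apply, h1, zero_mul] at h2
  exact Finsupp.mem_support_iff.mp hjm h2.symm

theorem grading_toAlgebra {E : DirectedGraph V Edge} (d : E.ClosedPath) :
    LeavittPathAlgebra.grading K E (d.toAlgebra K)
      = AddMonoidAlgebra.single (d.edges.length : ℤ) (d.toAlgebra K) := by
  rw [ClosedPath.toAlgebra]
  generalize d.edges = l
  induction l with
  | nil =>
    rw [List.map_nil, List.prod_nil, map_one]
    rfl
  | cons e l ih =>
    rw [List.map_cons, List.prod_cons, map_mul, ih, LeavittPathAlgebra.grading_of,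
      AddMonoidAlgebra.single_mul_single, LeavittPathAlgebra.degree, List.length_cons]
    congr 1
    push_cast
    ring

/-- Right multiplication by `d - 1` is injective. -/
theorem eq_zero_of_mul_toAlgebra_sub_one {E : DirectedGraph V Edge} (d : E.ClosedPath)
    {a : LeavittPathAlgebra K E} (h : a * (d.toAlgebra K - 1) = 0) : a = 0 := by
  apply LeavittPathAlgebra.grading_injective K E
  rw [map_zero]
  refine AddMonoidAlgebra.eq_zero_of_mul_single_eq_self (n := d.edges.length)
    (r := d.toAlgebra K) (by exact_mod_cast d.length_pos) ?_
  rw [← grading_toAlgebra, ← map_mul]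
  rw [mul_sub, mul_one, sub_eq_zero] at h
  rw [h]

end LeavittAlgebra

end DirectedGraph
namespace DirectedGraph

/-! ### The action on Chen modules and the annihilator of `d^∞`. -/

section Action

variable (K : Type u) [Field K] {V : Type v} {Edge : Type w} [Fintype V] [Fintype Edge]
variable {E : DirectedGraph V Edge}

/-- The path `τ_{>n}(p)` as an element of the class of `p`. -/
def TailClass.Paths.drop {c : E.TailClass} (p : c.Paths) (n : ℕ) : c.Paths :=
  ⟨p.1.drop n, (p.1.tailClass_drop n).trans p.2⟩

namespace ChenModule

variable {c : E.TailClass}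

theorem act_of (g : Generator V Edge) (p : c.Paths) :
    act K E c (LeavittPathAlgebra.of K E g) (ofPath K p) = basisAct K c g p := by
  rw [← freeAct_gen]
  exact DFunLike.congr_fun
    (RingQuot.liftAlgHom_mkAlgHom_apply K _ (fun _ _ h => freeAct_rel K c h) _) _

theorem of_smul_ofPath (g : Generator V Edge) (p : c.Paths) :
    LeavittPathAlgebra.of K E g • ofPath K p = basisAct K c g p :=
  act_of K g p

instance : IsScalarTower K (LeavittPathAlgebra K E) (ChenModule K c) where
  smul_assoc k a m := by
    change act K E c (k • a) m = k • act K E c a m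
    rw [map_smul, LinearMap.smul_apply]

theorem edge_smul_drop_one (p : c.Paths) {e : Edge} (he : p.1.step 0 = Sum.inl e) :
    LeavittPathAlgebra.of K E (.edge e) • ofPath K (p.drop 1) = ofPath K p := by
  have h : E.r e = (p.1.drop 1).source := by
    rw [InfPath.source_drop_one, he]
    rfl
  rw [of_smul_ofPath]
  refine (dif_pos h).trans (congrArg _ (Subtype.ext ?_))
  exact InfPath.cons_drop_one e p.1 h he

theorem vertex_smul_of_ne {x : V} {p : c.Paths} (h : x ≠ p.1.source) :
    LeavittPathAlgebra.of K E (.vertex x) • ofPath K p = 0 := by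
  rw [of_smul_ofPath]
  exact if_neg h

end ChenModule

variable (E) in
/-- A step of an infinite path as an element of `L_K(E)`. -/
noncomputable def stepAlgebra : E.Step → LeavittPathAlgebra K E :=
  Sum.elim (fun e => LeavittPathAlgebra.of K E (.edge e))
    fun x => LeavittPathAlgebra.of K E (.vertex x.1)

/-- The initial segment of length `n` of an infinite path as an element of `L_K(E)`. -/
noncomputable def InfPath.takeAlgebra (p : E.InfPath) : ℕ → LeavittPathAlgebra K E
  | 0 => 1
  | n + 1 => stepAlgebra K E (p.step 0) * InfPath.takeAlgebra (p.drop 1) n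

namespace InfPath

theorem takeAlgebra_zero (p : E.InfPath) : p.takeAlgebra K 0 = 1 := by
  rw [takeAlgebra]

theorem takeAlgebra_succ (p : E.InfPath) (n : ℕ) :
    p.takeAlgebra K (n + 1) = stepAlgebra K E (p.step 0) * (p.drop 1).takeAlgebra K n := by
  rw [takeAlgebra]

theorem takeAlgebra_add (p : E.InfPath) (m n : ℕ) :
    p.takeAlgebra K (m + n) = p.takeAlgebra K m * (p.drop m).takeAlgebra K n := by
  induction m generalizing p with
  | zero => rw [Nat.zero_add, takeAlgebra_zero, one_mul, drop_zero]
  | succ m ih =>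
    rw [Nat.add_right_comm, takeAlgebra_succ, takeAlgebra_succ, ih, drop_drop, mul_assoc,
      Nat.add_comm 1 m]

theorem takeAlgebra_smul_ofPath {c : E.TailClass} (p : c.Paths) (n : ℕ)
    (h : ∀ i < n, ∃ e, p.1.step i = Sum.inl e) :
    p.1.takeAlgebra K n • ChenModule.ofPath K (p.drop n) = ChenModule.ofPath K p := by
  induction n generalizing p with
  | zero =>
    rw [takeAlgebra_zero, one_smul]
    exact congrArg _ (Subtype.ext p.1.drop_zero)
  | succ n ih =>
    obtain ⟨e, he⟩ := h 0 n.succ_pos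
    have h1 : p.drop (n + 1) = (p.drop 1).drop n :=
      Subtype.ext (by rw [Nat.add_comm]; exact (drop_drop _ _ _).symm)
    rw [takeAlgebra_succ, mul_smul, h1]
    have h2 := ih (p.drop 1) fun i hi => by
      obtain ⟨f, hf⟩ := h (1 + i) (by omega)
      exact ⟨f, hf⟩
    refine (congrArg _ h2).trans ?_
    rw [he]
    exact ChenModule.edge_smul_drop_one K p he

theorem takeAlgebra_length (p : E.InfPath) (l : List Edge)
    (h : ∀ (i : ℕ) (hi : i < l.length), p.step i = Sum.inl l[i]) :
    p.takeAlgebra K l.length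
      = (l.map fun e => LeavittPathAlgebra.of K E (.edge e)).prod := by
  induction l generalizing p with
  | nil => simp [takeAlgebra_zero]
  | cons e l ih =>
    rw [List.length_cons, takeAlgebra_succ, h 0 (by simp), ih (p.drop 1), List.map_cons,
      List.prod_cons]
    · rfl
    · intro i hi
      have := h (i + 1) (by simpa using hi)
      simpa [drop, Nat.add_comm] using this

end InfPath

namespace ClosedPath

variable (d : E.ClosedPath)

theorem takeAlgebra_of_divides {p : E.InfPath} (h : d.Divides p) :
    p.takeAlgebra K d.edges.length = d.toAlgebra K :=
  p.takeAlgebra_length K _ fun i hi => by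
    rw [(d.divides_iff p).mp h i hi, d.infinity_step_of_lt hi]

theorem toAlgebra_mul_vertex_source :
    d.toAlgebra K * LeavittPathAlgebra.of K E (.vertex d.source) = d.toAlgebra K := by
  rw [toAlgebra, ← List.dropLast_append_getLast d.ne_nil, List.map_append, List.prod_append,
    mul_assoc, source, ← d.closed, List.map_singleton, List.prod_singleton,
    LeavittPathAlgebra.edge_mul_vertex_range]

theorem toAlgebra_smul_of_source_ne {c : E.TailClass} {p : c.Paths}
    (h : p.1.source ≠ d.source) : d.toAlgebra K • ChenModule.ofPath K p = 0 := by
  rw [← toAlgebra_mul_vertex_source, mul_smul, ChenModule.vertex_smul_of_ne K (Ne.symm h),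
    smul_zero]

theorem toAlgebra_smul_drop {c : E.TailClass} {p : c.Paths} (h : d.Divides p.1) :
    d.toAlgebra K • ChenModule.ofPath K (p.drop d.edges.length) = ChenModule.ofPath K p := by
  rw [← takeAlgebra_of_divides K d h]
  refine InfPath.takeAlgebra_smul_ofPath K p _ fun i hi => ?_
  rw [(d.divides_iff _).mp h i hi]
  exact ⟨_, rfl⟩

theorem toAlgebra_smul_infinity :
    d.toAlgebra K • ChenModule.ofPath K d.infinityMem = ChenModule.ofPath K d.infinityMem := by
  have h := toAlgebra_smul_drop K d (p := d.infinityMem) d.divides_infinity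
  rwa [show d.infinityMem.drop d.edges.length = d.infinityMem from
    Subtype.ext d.infinity_drop_length] at h

theorem toAlgebra_sub_one_smul_infinity :
    (d.toAlgebra K - 1) • ChenModule.ofPath K d.infinityMem = 0 := by
  rw [sub_smul, one_smul, toAlgebra_smul_infinity, sub_self]

/-! ### The sequence of a simple closed path -/

theorem takeAlgebra_smul_infinity (p : d.infinity.tailClass.Paths) {m : ℕ}
    (hm : p.1.drop m = d.infinity) :
    p.1.takeAlgebra K m • ChenModule.ofPath K d.infinityMem = ChenModule.ofPath K p := by
  have h : d.infinityMem = p.drop m := Subtype.ext hm.symm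
  rw [h]
  refine InfPath.takeAlgebra_smul_ofPath K p m fun i hi =>
    p.1.exists_step_eq_inl_of_le hi.le ?_
  obtain ⟨e, he⟩ := d.exists_infinity_step_eq_inl 0
  rw [← hm] at he
  exact ⟨e, he⟩

/-- The left ideal `L_K(E) (d - 1)`. -/
noncomputable abbrev ideal : Submodule (LeavittPathAlgebra K E) (LeavittPathAlgebra K E) :=
  Submodule.span (LeavittPathAlgebra K E) {d.toAlgebra K - 1}

theorem mk_mul_toAlgebra (a : LeavittPathAlgebra K E) :
    (d.ideal K).mkQ (a * d.toAlgebra K) = (d.ideal K).mkQ a := by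
  rw [Submodule.mkQ_apply, Submodule.mkQ_apply, Submodule.Quotient.eq]
  refine Submodule.mem_span_singleton.mpr ⟨a, ?_⟩
  rw [smul_eq_mul, mul_sub, mul_one]

theorem mk_mul_takeAlgebra_infinity (a : LeavittPathAlgebra K E) (k : ℕ) :
    (d.ideal K).mkQ (a * d.infinity.takeAlgebra K (k * d.edges.length)) = (d.ideal K).mkQ a := by
  induction k with
  | zero => rw [Nat.zero_mul, InfPath.takeAlgebra_zero, mul_one]
  | succ k ih =>
    rw [Nat.succ_mul, InfPath.takeAlgebra_add, infinity_drop_mul_length,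
      takeAlgebra_of_divides K d d.divides_infinity, ← mul_assoc, mk_mul_toAlgebra, ih]

theorem mk_takeAlgebra_add {p : E.InfPath} {m : ℕ} (hm : p.drop m = d.infinity) (k : ℕ) :
    (d.ideal K).mkQ (p.takeAlgebra K (m + k * d.edges.length))
      = (d.ideal K).mkQ (p.takeAlgebra K m) := by
  rw [InfPath.takeAlgebra_add, hm, mk_mul_takeAlgebra_infinity]

/-- Modulo `d - 1`, the initial segment `α` of `p = α d^∞` only depends on `p`. -/
theorem IsSimple.mk_takeAlgebra_eq {d : E.ClosedPath} (hd : d.IsSimple) {p : E.InfPath} {m n : ℕ}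
    (hm : p.drop m = d.infinity) (hn : p.drop n = d.infinity) :
    (d.ideal K).mkQ (p.takeAlgebra K m) = (d.ideal K).mkQ (p.takeAlgebra K n) := by
  wlog hmn : m ≤ n generalizing m n
  · exact (this hn hm (Nat.le_of_not_le hmn)).symm
  obtain ⟨j, rfl⟩ := Nat.exists_eq_add_of_le hmn
  rw [← InfPath.drop_drop, hm] at hn
  -- Simplicity enters here: the two cuts differ by a period, thus by whole turns of `d`, which act
  -- as `1` modulo `d - 1`.
  obtain ⟨k, rfl⟩ := hd.length_dvd_of_drop_eq hn
  rw [Nat.mul_comm, mk_takeAlgebra_add K d hm]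

/-- The classes modulo `d - 1` of the real paths `α` for which `α d^∞` is defined. -/
def segments : Set (LeavittPathAlgebra K E ⧸ d.ideal K) :=
  {x | ∃ (p : E.InfPath) (m : ℕ), p.drop m = d.infinity ∧
    x = (d.ideal K).mkQ (p.takeAlgebra K m)}

/-- Every element of `segments` is the class of an initial segment of length at least two. -/
theorem exists_of_mem_segments {x : LeavittPathAlgebra K E ⧸ d.ideal K} (hx : x ∈ d.segments K) :
    ∃ (p : E.InfPath) (m : ℕ) (e f : Edge), p.drop (m + 2) = d.infinity ∧
      p.step 0 = Sum.inl e ∧ p.step 1 = Sum.inl f ∧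
      x = (d.ideal K).mkQ (p.takeAlgebra K (m + 2)) := by
  obtain ⟨p, m, hm, rfl⟩ := hx
  -- Two extra turns of `d` do not change the class and add at least two edges.
  obtain ⟨n, hn⟩ : ∃ n, m + 2 * d.edges.length = n + 2 :=
    ⟨m + 2 * d.edges.length - 2, by have := d.length_pos; omega⟩
  have hd : p.drop (n + 2) = d.infinity := by
    rw [← hn, ← InfPath.drop_drop, hm, infinity_drop_mul_length]
  have hs : ∀ i ≤ n + 2, ∃ e, p.step i = Sum.inl e := fun i hi =>
    p.exists_step_eq_inl_of_le hi (by
      obtain ⟨e, he⟩ := d.exists_infinity_step_eq_inl 0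
      rw [← hd] at he
      exact ⟨e, he⟩)
  obtain ⟨e, he⟩ := hs 0 (by omega)
  obtain ⟨f, hf⟩ := hs 1 (by omega)
  exact ⟨p, n, e, f, hd, he, hf, by rw [← hn, mk_takeAlgebra_add K d hm]⟩

/-- A vertex fixes or kills a segment, an edge prolongs or kills it, a ghost edge shortens or kills
it. Length two is used for ghosts: `e* e = r(e)` must be absorbed by a next edge `f`. -/
theorem of_smul_mem_segments (g : Generator V Edge) {x : LeavittPathAlgebra K E ⧸ d.ideal K}
    (hx : x ∈ d.segments K) :
    LeavittPathAlgebra.of K E g • x ∈ insert 0 (d.segments K) := by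
  obtain ⟨p, m, e, f, hm, he, hf, rfl⟩ := exists_of_mem_segments K d hx
  have hf' : (p.drop 1).step 0 = Sum.inl f := hf
  have hs : ∀ a : LeavittPathAlgebra K E, a • (d.ideal K).mkQ (p.takeAlgebra K (m + 2))
      = (d.ideal K).mkQ (a * (LeavittPathAlgebra.of K E (.edge e)
        * (p.drop 1).takeAlgebra K (m + 1))) := fun a => by
    rw [← map_smul, smul_eq_mul, InfPath.takeAlgebra_succ K p (m + 1), he]
    rfl
  rw [hs]
  cases g with
  | vertex x =>
    by_cases hx : x = E.s e
    · right
      refine ⟨p, m + 2, hm, ?_⟩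
      rw [← mul_assoc, hx, LeavittPathAlgebra.vertex_mul_edge_source,
        InfPath.takeAlgebra_succ K p, he]
      rfl
    · left
      rw [← mul_assoc, LeavittPathAlgebra.vertex_mul_edge_of_ne K E hx, zero_mul, map_zero]
  | edge e' =>
    by_cases hr : E.r e' = E.s e
    · right
      have hr' : E.r e' = p.source := by
        rw [hr, InfPath.source, he]
        rfl
      refine ⟨p.cons e' hr', m + 3, by rw [InfPath.cons_drop_succ, hm], ?_⟩
      rw [InfPath.takeAlgebra_succ K (p.cons e' hr'), InfPath.drop_one_cons,
        InfPath.takeAlgebra_succ K p, he]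
      rfl
    · left
      rw [← mul_assoc, LeavittPathAlgebra.edge_mul_edge_of_ne K E hr, zero_mul, map_zero]
  | ghost e' =>
    by_cases hee : e' = e
    · right
      refine ⟨p.drop 1, m + 1, by rw [InfPath.drop_drop, Nat.add_comm, hm], ?_⟩
      have hr : E.r e = E.s f := by
        have := p.comp 0
        rwa [he, hf] at this
      have h1 : LeavittPathAlgebra.of K E (.vertex (E.s f)) * (p.drop 1).takeAlgebra K (m + 1)
          = (p.drop 1).takeAlgebra K (m + 1) := by
        rw [InfPath.takeAlgebra_succ, hf', ← mul_assoc]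
        exact congrArg (· * _) (LeavittPathAlgebra.vertex_mul_edge_source K E f)
      rw [← mul_assoc, hee, LeavittPathAlgebra.ghost_mul_edge_self, hr, h1]
    · left
      rw [← mul_assoc, LeavittPathAlgebra.ghost_mul_edge_of_ne K E hee, zero_mul, map_zero]

/-- The span is stable under the generators, hence under `L_K(E)`, and contains the class of `1`,
the empty initial segment of `d^∞`. -/
theorem span_segments : Submodule.span K (d.segments K) = ⊤ := by
  have hmul (a : LeavittPathAlgebra K E) : ∀ x ∈ Submodule.span K (d.segments K),
      a • x ∈ Submodule.span K (d.segments K) := by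
    have ha : a ∈ Algebra.adjoin K (Set.range (LeavittPathAlgebra.of K E)) := by
      rw [LeavittPathAlgebra.adjoin_range_of]
      trivial
    induction ha using Algebra.adjoin_induction with
    | mem y hy =>
      obtain ⟨g, rfl⟩ := hy
      intro x hx
      induction hx using Submodule.span_induction with
      | mem x hx =>
        rcases of_smul_mem_segments K d g hx with h | h
        · rw [h]
          exact Submodule.zero_mem _
        · exact Submodule.subset_span h
      | zero => rw [smul_zero]; exact Submodule.zero_mem _
      | add x y _ _ h1 h2 => rw [smul_add]; exact Submodule.add_mem _ h1 h2
      | smul k x _ h1 => rw [smul_comm]; exact Submodule.smul_mem _ _ h1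
    | algebraMap k =>
      intro x hx
      rw [algebraMap_smul]
      exact Submodule.smul_mem _ _ hx
    | add a b _ _ h1 h2 =>
      intro x hx
      rw [add_smul]
      exact Submodule.add_mem _ (h1 x hx) (h2 x hx)
    | mul a b _ _ h1 h2 =>
      intro x hx
      rw [mul_smul]
      exact h1 _ (h2 x hx)
  rw [eq_top_iff]
  rintro x -
  obtain ⟨a, rfl⟩ := (d.ideal K).mkQ_surjective x
  have h1 : (d.ideal K).mkQ 1 ∈ Submodule.span K (d.segments K) :=
    Submodule.subset_span ⟨d.infinity, 0, d.infinity.drop_zero, by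
      rw [InfPath.takeAlgebra_zero]⟩
  have h2 := hmul a _ h1
  rwa [← map_smul, smul_eq_mul, mul_one] at h2

/-- The inverse of the map `L_K(E) / L_K(E) (d - 1) → V_{[d^∞]}`. -/
noncomputable def chenToQuotient :
    ChenModule K d.infinity.tailClass →ₗ[K] LeavittPathAlgebra K E ⧸ d.ideal K :=
  Finsupp.linearCombination K fun p : d.infinity.tailClass.Paths =>
    (d.ideal K).mkQ (p.1.takeAlgebra K (d.exists_drop_eq_infinity p).choose)

theorem chenToQuotient_ofPath (p : d.infinity.tailClass.Paths) :
    d.chenToQuotient K (ChenModule.ofPath K p)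
      = (d.ideal K).mkQ (p.1.takeAlgebra K (d.exists_drop_eq_infinity p).choose) := by
  refine (Finsupp.linearCombination_single K _ _).trans ?_
  rw [one_smul]

/-- The map `L_K(E) / L_K(E) (d - 1) → V_{[d^∞]}` induced by `a ↦ a d^∞`. -/
noncomputable def quotientToChen : (LeavittPathAlgebra K E ⧸ d.ideal K) →ₗ[LeavittPathAlgebra K E]
    ChenModule K d.infinity.tailClass :=
  (d.ideal K).liftQ
    (LinearMap.toSpanSingleton _ _ (ChenModule.ofPath K d.infinityMem)) (by
      rw [Submodule.span_le, Set.singleton_subset_iff]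
      exact toAlgebra_sub_one_smul_infinity K d)

theorem quotientToChen_mk (a : LeavittPathAlgebra K E) :
    d.quotientToChen K ((d.ideal K).mkQ a) = a • ChenModule.ofPath K d.infinityMem := rfl

/-- A `K`-linear left inverse suffices for injectivity, so `chenToQuotient` need not be
`L_K(E)`-linear and the check on `segments` is enough. There the composite merely moves the cut
point of `α d^∞`. -/
theorem IsSimple.chenToQuotient_quotientToChen {d : E.ClosedPath} (hd : d.IsSimple)
    (x : LeavittPathAlgebra K E ⧸ d.ideal K) :
    d.chenToQuotient K (d.quotientToChen K x) = x := by
  have hx : x ∈ Submodule.span K (d.segments K) := by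
    rw [span_segments]
    trivial
  induction hx using Submodule.span_induction with
  | mem x hx =>
    obtain ⟨p, m, hm, rfl⟩ := hx
    have hp : p.tailClass = d.infinity.tailClass := by rw [← hm, InfPath.tailClass_drop]
    rw [quotientToChen_mk, takeAlgebra_smul_infinity K d ⟨p, hp⟩ hm, chenToQuotient_ofPath]
    exact hd.mk_takeAlgebra_eq K (d.exists_drop_eq_infinity ⟨p, hp⟩).choose_spec hm
  | zero => rw [map_zero, map_zero]
  | add x y _ _ h1 h2 => rw [map_add, map_add, h1, h2]
  | smul k x _ h1 => rw [LinearMap.map_smul_of_tower, map_smul, h1]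

/-- The annihilator of `d^∞` is the left ideal generated by `d - 1`. -/
theorem IsSimple.exists_mul_of_smul_infinity_eq_zero {d : E.ClosedPath} (hd : d.IsSimple)
    {a : LeavittPathAlgebra K E} (ha : a • ChenModule.ofPath K d.infinityMem = 0) :
    ∃ b, b * (d.toAlgebra K - 1) = a := by
  have h := hd.chenToQuotient_quotientToChen K ((d.ideal K).mkQ a)
  rw [quotientToChen_mk, ha, map_zero] at h
  exact Submodule.mem_span_singleton.mp ((Submodule.Quotient.mk_eq_zero _).mp h.symm)

theorem exists_smul_infinity (x : ChenModule K d.infinity.tailClass) :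
    ∃ a : LeavittPathAlgebra K E, a • ChenModule.ofPath K d.infinityMem = x := by
  induction x using Finsupp.induction_linear with
  | zero => exact ⟨0, zero_smul _ _⟩
  | add x y h1 h2 =>
    obtain ⟨a, rfl⟩ := h1
    obtain ⟨b, rfl⟩ := h2
    exact ⟨a + b, add_smul _ _ _⟩
  | single p k =>
    obtain ⟨m, hm⟩ := d.exists_drop_eq_infinity p
    refine ⟨k • p.1.takeAlgebra K m, ?_⟩
    rw [smul_assoc, takeAlgebra_smul_infinity K d p hm]
    exact (Finsupp.smul_single _ _ _).trans (by rw [smul_eq_mul, mul_one])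

end ClosedPath

end Action

end DirectedGraph
namespace DirectedGraph

/-! ### Cancelling powers of `d` from the front of a path. -/

section Terminal

variable {V : Type v} {Edge : Type w} {E : DirectedGraph V Edge}

namespace ClosedPath

variable (d : E.ClosedPath)

/-- `d.Reaches p s` if `p = d^k s` for some `k`. -/
inductive Reaches : E.InfPath → E.InfPath → Prop
  | refl (p : E.InfPath) : Reaches p p
  | step {p s : E.InfPath} (hp : d.Divides p) (h : Reaches (p.drop d.edges.length) s) :
      Reaches p s

variable {d} in
theorem Reaches.eq_of_infinity {p s : E.InfPath} (h : d.Reaches p s) (hp : p = d.infinity) :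
    s = d.infinity := by
  induction h with
  | refl p => exact hp
  | step _ _ ih => exact ih (by rw [hp, infinity_drop_length])

-- Cancelling `d` is deterministic: it stops at a path not divisible by `d`, while `d^∞` is a fixed
-- point.
variable {d} in
theorem Reaches.unique {p s t : E.InfPath} (h : d.Reaches p s) (h' : d.Reaches p t)
    (hs : ¬ d.Divides s ∨ s = d.infinity) (ht : ¬ d.Divides t ∨ t = d.infinity) : s = t := by
  induction h with
  | refl p =>
    cases h' with
    | refl => rfl
    | step hp h' =>
      have hp' := hs.resolve_left (not_not_intro hp)
      rw [hp', Reaches.eq_of_infinity (Reaches.step hp h') hp']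
  | step hp h ih =>
    cases h' with
    | refl =>
      have hp' := ht.resolve_left (not_not_intro hp)
      rw [hp', Reaches.eq_of_infinity (Reaches.step hp h) hp']
    | step _ h' => exact ih h' hs

variable {d} in
theorem Reaches.source_eq {p s : E.InfPath} (h : d.Reaches p s) (hs : s.source = d.source) :
    p.source = d.source := by
  cases h with
  | refl => exact hs
  | step hp _ => exact d.source_of_divides hp

/-- The set `L_{(d,q)}` together with `d^∞` if `d^∞ ∈ [q]`. -/
def terminal (c : E.TailClass) : Set c.Paths :=
  {p | p.1.source = d.source ∧ (¬ d.Divides p.1 ∨ p.1 = d.infinity)}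

theorem terminal_eq_L {c : E.TailClass} (hc : c ≠ d.infinity.tailClass) :
    d.terminal c = d.L c := by
  ext p
  have hp : p.1 ≠ d.infinity := fun h => hc (p.2.symm.trans (congrArg _ h))
  simp only [terminal, L, Set.mem_ofPred_eq, hp, or_false]

theorem terminal_infinity :
    d.terminal d.infinity.tailClass = insert d.infinityMem (d.L d.infinity.tailClass) := by
  ext p
  have hp : p = d.infinityMem ↔ p.1 = d.infinity := Subtype.ext_iff
  simp only [terminal, L, Set.mem_ofPred_eq, Set.mem_insert_iff, hp]
  constructor
  · rintro ⟨h1, h2 | h2⟩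
    · exact Or.inr ⟨h1, h2⟩
    · exact Or.inl h2
  · rintro (h | ⟨h1, h2⟩)
    · exact ⟨by rw [h, source_infinity], Or.inr h⟩
    · exact ⟨h1, Or.inl h2⟩

theorem infinityMem_notMem_L : d.infinityMem ∉ d.L d.infinity.tailClass :=
  fun h => h.2 d.divides_infinity

theorem exists_reaches {c : E.TailClass} (p : c.Paths) (hp : p.1.source = d.source) :
    ∃ s : d.terminal c, d.Reaches p.1 s.1.1 := by
  -- If all the cancellations succeed, then `p = d^∞`. Otherwise induct on `k`, which need not be
  -- the first failure.
  by_cases h : ∃ k, ¬ d.Divides (p.1.drop (k * d.edges.length))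
  · obtain ⟨k, hk⟩ := h
    induction k generalizing p with
    | zero =>
      rw [Nat.zero_mul, InfPath.drop_zero] at hk
      exact ⟨⟨p, hp, Or.inl hk⟩, Reaches.refl _⟩
    | succ k ih =>
      by_cases hd : d.Divides p.1
      · obtain ⟨s, hs⟩ := ih ⟨p.1.drop d.edges.length, (p.1.tailClass_drop _).trans p.2⟩
          (d.source_drop_of_divides hd) (by
            rwa [InfPath.drop_drop, Nat.add_comm, ← Nat.succ_mul])
        exact ⟨s, Reaches.step hd hs⟩
      · exact ⟨⟨p, hp, Or.inl hd⟩, Reaches.refl _⟩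
  · push Not at h
    exact ⟨⟨p, hp, Or.inr (d.eq_infinity_of_forall_divides h)⟩, Reaches.refl _⟩

end ClosedPath

end Terminal

/-! ### The cokernel of `d - 1` on `V_{[q]}`. -/

section Cokernel

variable (K : Type u) [Field K] {V : Type v} {Edge : Type w}
variable {E : DirectedGraph V Edge}

namespace ClosedPath

variable (d : E.ClosedPath) (c : E.TailClass)

open Classical in
/-- The linear map `V_{[q]} → K^{(L_{(d,q)})}` that sends `d^k s` to `s` and every path that does
not start at `s(d)` to `0`. -/
noncomputable def retraction : ChenModule K c →ₗ[K] (d.terminal c →₀ K) :=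
  Finsupp.linearCombination K fun p : c.Paths =>
    if h : p.1.source = d.source then Finsupp.single (d.exists_reaches p h).choose 1 else 0

theorem retraction_of_source_ne {p : c.Paths} (h : p.1.source ≠ d.source) :
    d.retraction K c (ChenModule.ofPath K p) = 0 := by
  refine (Finsupp.linearCombination_single K _ _).trans ?_
  rw [one_smul, dif_neg h]

/-- By `Reaches.unique` the choice made in `retraction` is immaterial. -/
theorem retraction_of_reaches {p : c.Paths} {s : d.terminal c} (h : d.Reaches p.1 s.1.1) :
    d.retraction K c (ChenModule.ofPath K p) = Finsupp.single s 1 := by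
  have hp : p.1.source = d.source := h.source_eq s.2.1
  refine (Finsupp.linearCombination_single K _ _).trans ?_
  rw [one_smul, dif_pos hp]
  have hc := (d.exists_reaches p hp).choose_spec
  congr 1
  exact Subtype.ext (Subtype.ext (hc.unique h (d.exists_reaches p hp).choose.2.2 s.2.2))

/-- The linear map that sends a basis vector to the corresponding path. -/
noncomputable def inclusion : (d.terminal c →₀ K) →ₗ[K] ChenModule K c :=
  Finsupp.linearCombination K fun p => ChenModule.ofPath K p.1

theorem inclusion_single (p : d.terminal c) :
    d.inclusion K c (Finsupp.single p 1) = ChenModule.ofPath K p.1 := by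
  rw [inclusion, Finsupp.linearCombination_single, one_smul]

theorem retraction_inclusion (x : d.terminal c →₀ K) :
    d.retraction K c (d.inclusion K c x) = x := by
  suffices h : (d.retraction K c).comp (d.inclusion K c) = LinearMap.id from
    LinearMap.congr_fun h x
  refine Finsupp.lhom_ext' fun p => LinearMap.ext_ring ?_
  change d.retraction K c (d.inclusion K c (Finsupp.single p 1)) = Finsupp.single p 1
  rw [inclusion_single, retraction_of_reaches K d c (Reaches.refl _)]

variable [Fintype V] [Fintype Edge]

/-- `p` and `d p` reach the same terminal path; if `s(p) ≠ s(d)`, both `d p` and the image of `p`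
vanish. -/
theorem retraction_smul (x : ChenModule K c) :
    d.retraction K c ((d.toAlgebra K - 1) • x) = 0 := by
  suffices h : (d.retraction K c).comp
      (ChenModule.act K E c (d.toAlgebra K - 1)) = 0 from LinearMap.congr_fun h x
  refine Finsupp.lhom_ext' fun p => LinearMap.ext_ring ?_
  change d.retraction K c ((d.toAlgebra K - 1) • ChenModule.ofPath K p) = 0
  rw [sub_smul, one_smul, map_sub]
  by_cases hp : p.1.source = d.source
  · obtain ⟨s, hs⟩ := d.exists_reaches p hp
    let p' : c.Paths := ⟨d.append p.1 hp, (d.tailClass_append p.1 hp).trans p.2⟩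
    have hd : p'.drop d.edges.length = p := Subtype.ext (d.append_drop_length p.1 hp)
    have h1 := d.toAlgebra_smul_drop K (p := p') (d.divides_append p.1 hp)
    rw [hd] at h1
    have hs' : d.Reaches p'.1 s.1.1 := by
      refine Reaches.step (d.divides_append p.1 hp) ?_
      rwa [append_drop_length]
    rw [h1, retraction_of_reaches K d c hs, retraction_of_reaches K d c hs', sub_self]
  · rw [toAlgebra_smul_of_source_ne K d hp, retraction_of_source_ne K d c hp, map_zero,
      sub_zero]

/-- Telescoping sum of the relations `d p' - p' = (d - 1) p'`, one for each cancelled `d`. -/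
theorem sub_mem_range_of_reaches {p s : E.InfPath} (h : d.Reaches p s)
    (hp : p.tailClass = c) (hs : s.tailClass = c) :
    ChenModule.ofPath K ⟨p, hp⟩ - ChenModule.ofPath K ⟨s, hs⟩
      ∈ LinearMap.range (ChenModule.act K E c (d.toAlgebra K - 1)) := by
  induction h with
  | refl p => rw [sub_self]; exact Submodule.zero_mem _
  | @step p s hd _ ih =>
    let p' : c.Paths := ⟨p, hp⟩
    have h1 : ChenModule.ofPath K p' - ChenModule.ofPath K (p'.drop d.edges.length)
        ∈ LinearMap.range (ChenModule.act K E c (d.toAlgebra K - 1)) := by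
      refine ⟨ChenModule.ofPath K (p'.drop d.edges.length), ?_⟩
      change (d.toAlgebra K - 1) • ChenModule.ofPath K (p'.drop d.edges.length) = _
      rw [sub_smul, one_smul, toAlgebra_smul_drop K d (p := p') hd]
    have h2 := Submodule.add_mem _ h1 (ih (p'.drop d.edges.length).2 hs)
    rwa [← sub_add_sub_cancel _ (ChenModule.ofPath K (p'.drop d.edges.length))]

theorem sub_inclusion_retraction_mem (x : ChenModule K c) :
    x - d.inclusion K c (d.retraction K c x)
      ∈ LinearMap.range (ChenModule.act K E c (d.toAlgebra K - 1)) := by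
  set Q := LinearMap.range (ChenModule.act K E c (d.toAlgebra K - 1)) with hQ
  suffices h : Q.mkQ.comp (LinearMap.id - (d.inclusion K c).comp (d.retraction K c)) = 0 from
    (Submodule.Quotient.mk_eq_zero _).mp (LinearMap.congr_fun h x)
  refine Finsupp.lhom_ext' fun p => LinearMap.ext_ring ?_
  refine (Submodule.Quotient.mk_eq_zero _).mpr ?_
  change ChenModule.ofPath K p - d.inclusion K c (d.retraction K c (ChenModule.ofPath K p)) ∈ Q
  by_cases hp : p.1.source = d.source
  · obtain ⟨s, hs⟩ := d.exists_reaches p hp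
    rw [retraction_of_reaches K d c hs, inclusion_single]
    exact sub_mem_range_of_reaches K d c hs p.2 s.1.2
  · rw [retraction_of_source_ne K d c hp, map_zero, sub_zero]
    -- As `d` kills `p`, one has `(d - 1)(-p) = p`.
    refine ⟨-ChenModule.ofPath K p, ?_⟩
    change (d.toAlgebra K - 1) • -ChenModule.ofPath K p = _
    rw [smul_neg, sub_smul, one_smul, toAlgebra_smul_of_source_ne K d hp, zero_sub, neg_neg]

/-- A surjection from `V_{[q]}` with kernel `(d - 1) V_{[q]}` maps the terminal paths to a
basis. -/
theorem exists_basis_of_surjective {X : Type*} [AddCommGroup X] [Module K X]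
    (f : ChenModule K c →ₗ[K] X) (hf : Function.Surjective f)
    (hker : ∀ x, f x = 0 ↔ ∃ y, (d.toAlgebra K - 1) • y = x) :
    ∃ b : Module.Basis (d.terminal c) K X, ∀ p, b p = f (ChenModule.ofPath K p.1) := by
  -- Injective because `retraction` undoes `inclusion` and kills `(d - 1) V_{[q]}`; surjective
  -- because `x` and its retraction agree modulo `(d - 1) V_{[q]}`.
  have hbij : Function.Bijective (f.comp (d.inclusion K c)) := by
    constructor
    · rw [← LinearMap.ker_eq_bot, LinearMap.ker_eq_bot']
      intro x hx
      obtain ⟨y, hy⟩ := (hker _).mp hx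
      rw [← d.retraction_inclusion K c x, ← hy, retraction_smul]
    · intro z
      obtain ⟨x, rfl⟩ := hf z
      refine ⟨d.retraction K c x, ?_⟩
      obtain ⟨y, hy⟩ := d.sub_inclusion_retraction_mem K c x
      have h := (hker _).mpr ⟨y, hy⟩
      rw [map_sub, sub_eq_zero] at h
      exact h.symm
  refine ⟨Module.Basis.ofRepr (LinearEquiv.ofBijective _ hbij).symm, fun p => ?_⟩
  change f (d.inclusion K c (Finsupp.single p 1)) = _
  rw [inclusion_single]

end ClosedPath

end Cokernel

/-! ### Exactness of the sequence and `Ext¹` as a cokernel. -/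

section Ext

open CategoryTheory

variable (K : Type u) [Field K] {V : Type v} {Edge : Type w} [Fintype V] [Fintype Edge]
variable {E : DirectedGraph V Edge} (d : E.ClosedPath)

theorem rhoSubOne_comp_rhoPath : rhoSubOne K d ≫ rhoPath K d.infinityMem = 0 := by
  refine ModuleCat.hom_ext (LinearMap.ext fun a => ?_)
  change (a * (d.toAlgebra K - 1)) • ChenModule.ofPath K d.infinityMem = 0
  rw [mul_smul, ClosedPath.toAlgebra_sub_one_smul_infinity, smul_zero]

theorem ClosedPath.IsSimple.shortExact {d : E.ClosedPath} (hd : d.IsSimple) :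
    (ShortComplex.mk (rhoSubOne K d) (rhoPath K d.infinityMem)
      (rhoSubOne_comp_rhoPath K d)).ShortExact where
  exact := by
    rw [ShortComplex.moduleCat_exact_iff]
    intro a ha
    exact hd.exists_mul_of_smul_infinity_eq_zero K ha
  mono_f := by
    rw [ModuleCat.mono_iff_injective, injective_iff_map_eq_zero]
    intro a ha
    exact eq_zero_of_mul_toAlgebra_sub_one K d ha
  epi_g := by
    rw [ModuleCat.epi_iff_surjective]
    exact d.exists_smul_infinity K

variable {K d}
variable (hS : (ShortComplex.mk (rhoSubOne K d) (rhoPath K d.infinityMem)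
  (rhoSubOne_comp_rhoPath K d)).ShortExact) (c : E.TailClass)

theorem connecting_smul {S : ShortComplex (ModuleCat.{max u v w} (LeavittPathAlgebra K E))}
    (hS : S.ShortExact) {T : ModuleCat.{max u v w} (LeavittPathAlgebra K E)} (k : K)
    (φ : S.X₁ ⟶ T) : connecting hS (k • φ) = k • connecting hS φ := by
  rw [connecting, Abelian.Ext.mk₀_smul, Abelian.Ext.comp_smul]
  rfl

/-- Scalars from `K` are central, so they can be moved past `a` in `a ↦ a m`. -/
theorem rho_algebraMap_smul {M : ModuleCat.{max u v w} (LeavittPathAlgebra K E)} (k : K) (m : M) :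
    rho (algebraMap K (LeavittPathAlgebra K E) k • m) = k • rho m := by
  refine ModuleCat.hom_ext (LinearMap.ext fun a => ?_)
  change a • algebraMap K (LeavittPathAlgebra K E) k • m
    = algebraMap K (LeavittPathAlgebra K E) k • a • m
  rw [smul_smul, smul_smul, Algebra.commutes]

/-- The linear map `m ↦ π(ρ̂_m)` from `V_{[q]}` to `Ext¹`. -/
noncomputable def connectingRho : ChenModule K c →ₗ[K]
    Abelian.Ext.{max u v w} (chenModule K d.infinity.tailClass) (chenModule K c) 1 where
  toFun m := connecting hS (rho (M := chenModule K c) m)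
  map_add' m n := by
    have h : rho (M := chenModule K c) (m + n)
        = rho (M := chenModule K c) m + rho (M := chenModule K c) n :=
      ModuleCat.hom_ext (LinearMap.ext fun a => smul_add a m n)
    rw [h, connecting, Abelian.Ext.mk₀_add, Abelian.Ext.comp_add]
    rfl
  map_smul' k m := by
    rw [← algebraMap_smul (LeavittPathAlgebra K E) k m]
    exact (congrArg (connecting hS) (rho_algebraMap_smul k (M := chenModule K c) m)).trans
      (connecting_smul hS k _)

/-- `Ext¹` of the projective middle term vanishes, so every class is `π(φ)`, and `φ = ρ̂_m` with `m
= φ(1)`. -/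
theorem connectingRho_surjective : Function.Surjective (connectingRho hS c) := by
  intro x
  have : Projective (regularModule K E) := inferInstance
  obtain ⟨y, hy⟩ := Abelian.Ext.contravariant_sequence_exact₃ hS (chenModule K c) x
    (Abelian.Ext.eq_zero_of_projective _) (add_zero 1)
  obtain ⟨φ, rfl⟩ := Abelian.Ext.homEquiv₀.symm.surjective y
  refine ⟨φ.hom (1 : LeavittPathAlgebra K E), ?_⟩
  rw [← hy]
  have h : rho (M := chenModule K c) (φ.hom (1 : LeavittPathAlgebra K E)) = φ := by
    refine ModuleCat.hom_ext (LinearMap.ext_ring ?_)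
    exact one_smul (LeavittPathAlgebra K E) _
  change connecting hS (rho (M := chenModule K c) (φ.hom (1 : LeavittPathAlgebra K E))) = _
  rw [h]
  rfl

/-- By the long exact sequence `π(ρ̂_m) = 0` exactly when `ρ̂_m` factors as `φ` after `ρ̂_{d-1}`;
evaluation at `1` turns this into `m = (d - 1) φ(1)`. -/
theorem connectingRho_eq_zero_iff (m : ChenModule K c) :
    connectingRho hS c m = 0 ↔ ∃ y : ChenModule K c, (d.toAlgebra K - 1) • y = m := by
  constructor
  · intro h
    obtain ⟨x, hx⟩ := Abelian.Ext.contravariant_sequence_exact₁ hS (chenModule K c)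
      (Abelian.Ext.mk₀ (rho (M := chenModule K c) m)) (add_zero 1) h
    obtain ⟨φ, rfl⟩ := Abelian.Ext.homEquiv₀.symm.surjective x
    have h1 : rhoSubOne K d ≫ φ = rho (M := chenModule K c) m := by
      apply Abelian.Ext.homEquiv₀.symm.injective
      exact (Abelian.Ext.mk₀_comp_mk₀ _ _).symm.trans hx
    refine ⟨φ.hom (1 : LeavittPathAlgebra K E), ?_⟩
    have h2 := LinearMap.congr_fun (congrArg ModuleCat.Hom.hom h1) (1 : LeavittPathAlgebra K E)
    change φ.hom ((1 : LeavittPathAlgebra K E) * (d.toAlgebra K - 1))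
      = (1 : LeavittPathAlgebra K E) • m at h2
    rw [one_mul, one_smul] at h2
    rw [← h2]
    have h3 := φ.hom.map_smul (d.toAlgebra K - 1) (1 : LeavittPathAlgebra K E)
    rw [smul_eq_mul, mul_one] at h3
    exact h3.symm
  · rintro ⟨y, rfl⟩
    have h : rho (M := chenModule K c) ((d.toAlgebra K - 1) • y)
        = rhoSubOne K d ≫ rho (M := chenModule K c) y :=
      ModuleCat.hom_ext (LinearMap.ext fun a => (mul_smul a (d.toAlgebra K - 1) y).symm)
    change connecting hS (rho (M := chenModule K c) ((d.toAlgebra K - 1) • y)) = 0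
    rw [h, connecting, ← Abelian.Ext.mk₀_comp_mk₀]
    exact hS.extClass_comp_assoc _

theorem exists_basis_terminal : ∃ b : Module.Basis (d.terminal c) K
      (Abelian.Ext.{max u v w} (chenModule K d.infinity.tailClass) (chenModule K c) 1),
    ∀ p : d.terminal c, b p = connecting hS (rhoPath K p.1) :=
  d.exists_basis_of_surjective K c (connectingRho hS c) (connectingRho_surjective hS c)
    (connectingRho_eq_zero_iff hS c)

end Ext

theorem rank_eq_lift_mk_of_basis {K : Type u} [Field K] {ι : Type v} {M : Type max u v}
    [AddCommGroup M] [Module K M] (b : Module.Basis ι K M) :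
    Module.rank K M = Cardinal.lift.{u} (Cardinal.mk ι) := by
  have h := b.mk_eq_rank
  rw [Cardinal.lift_id'.{v, max u v}, Cardinal.lift_umax.{v, u}] at h
  exact h.symm

end DirectedGraph

open CategoryTheory DirectedGraph in
theorem mainTheorem7 {K : Type u} [Field K] {V : Type v} {Edge : Type w} [Fintype V] [Fintype Edge]
    (E : DirectedGraph V Edge) (d : E.ClosedPath) (hd : d.IsSimple) (q : E.InfPath) :
    ∃ (h0 : rhoSubOne K d ≫ rhoPath K d.infinityMem = 0)
      (hS : (ShortComplex.mk (rhoSubOne K d) (rhoPath K d.infinityMem) h0).ShortExact),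
      (q.tailClass ≠ d.infinity.tailClass →
        Module.rank K (Abelian.Ext.{max u v w}
            (chenModule K d.infinity.tailClass) (chenModule K q.tailClass) 1)
          = Cardinal.lift.{u} (Cardinal.mk (d.L q.tailClass)) ∧
        ∃ b : Module.Basis (d.L q.tailClass) K (Abelian.Ext.{max u v w}
            (chenModule K d.infinity.tailClass) (chenModule K q.tailClass) 1),
          ∀ p : d.L q.tailClass, b p = connecting hS (rhoPath K p.1)) ∧
      (Module.rank K (Abelian.Ext.{max u v w}
            (chenModule K d.infinity.tailClass) (chenModule K d.infinity.tailClass) 1)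
          = Cardinal.lift.{u} (Cardinal.mk (d.L d.infinity.tailClass)) + 1 ∧
        d.infinityMem ∉ d.L d.infinity.tailClass ∧
        ∃ b : Module.Basis (insert d.infinityMem (d.L d.infinity.tailClass) : Set _) K
            (Abelian.Ext.{max u v w}
              (chenModule K d.infinity.tailClass) (chenModule K d.infinity.tailClass) 1),
          ∀ p : (insert d.infinityMem (d.L d.infinity.tailClass) : Set _),
            b p = connecting hS (rhoPath K p.1)) := by
  refine ⟨rhoSubOne_comp_rhoPath K d, hd.shortExact K, fun hq => ?_, ?_⟩
  · have h := exists_basis_terminal (hd.shortExact K) q.tailClass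
    rw [d.terminal_eq_L hq] at h
    refine ⟨?_, h⟩
    obtain ⟨b, -⟩ := h
    exact rank_eq_lift_mk_of_basis b
  · have h := exists_basis_terminal (hd.shortExact K) d.infinity.tailClass
    rw [d.terminal_infinity] at h
    refine ⟨?_, d.infinityMem_notMem_L, h⟩
    obtain ⟨b, -⟩ := h
    rw [rank_eq_lift_mk_of_basis b, Cardinal.mk_insert d.infinityMem_notMem_L, Cardinal.lift_add,
      Cardinal.lift_one]
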